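/- All graphs are finite and simple. For a graph $H$ with at least one edge, a graph $G$ is $H$-saturated if $G$ has no subgraph isomorphic to $H$, but joining any two distinct nonadjacent vertices of $G$ by a new edge creates such a subgraph. The saturation number $\operatorname{sat}(n,H)$ is the minimum number of edges of an $H$-saturated graph on $n$ vertices. For positive integers $s \le t$, the double star $S_{s,t}$ is the tree on $s+t$ vertices obtained from a star of order $s$ and a star of order $t$ by joining their centers by an edge, so that the two centers have degrees $s$ and $t$. **Theorem.** Let $2 \le s < t$ be integers and let $q = \max\{1, \lfloor s/2 \rfloor - 1\}$. For every integer $n \ge q(2t+4) + s$, \[ \frac{s(t+1)}{t+2}\cdot\frac n2 - c_1 \;\le\; \operatorname{sat}(n, S_{s,t}) \;\le\; \frac{s(t+1)}{t+2}\cdot\frac n2 + c_2, \] where \[ c_1 = \frac{s(t-s+2)}{2t+4} + \frac{s^2}{8}, \qquad c_2 = \frac{s(s-1)}{2t+4} + \left\lceil \frac s2 \right\rceil . \] In particular, for fixed $s$ and $t$, $\operatorname{sat}(n,S_{s,t}) = \dfrac{(st+s)\,n}{2t+4} + O(1)$ as $n \to \infty$. -/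

import Mathlib

namespace SaturationNumber

/-- `G` is `H`-saturated: `G` contains no subgraph isomorphic to `H`, but adding any edge between
two distinct nonadjacent vertices of `G` creates such a subgraph. -/
def IsSaturated {W V : Type*} (H : SimpleGraph W) (G : SimpleGraph V) : Prop :=
  H.Free G ∧ ∀ x y : V, x ≠ y → ¬ G.Adj x y → H.IsContained (G ⊔ SimpleGraph.edge x y)

/-- The saturation number of `H`: the minimum number of edges of an `H`-saturated graph with
`n` vertices. The minimum is attained as soon as `H` has an edge
(see `exists_isSaturated_ncard_eq_sat`). -/
noncomputable def sat {W : Type*} (n : ℕ) (H : SimpleGraph W) : ℕ :=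
  sInf {m : ℕ | ∃ G : SimpleGraph (Fin n), IsSaturated H G ∧ G.edgeSet.ncard = m}

/-- The double star `S_{s,t}` (for positive `s` and `t`): a star of order `s` with vertex set
`Fin s` and center `0`, a star of order `t` with vertex set `Fin t` and center `0`, and an edge
that joins the two centers. -/
def doubleStar (s t : ℕ) : SimpleGraph (Fin s ⊕ Fin t) :=
  SimpleGraph.fromRel fun x y =>
    match x, y with
    | Sum.inl i, Sum.inl _ => i.val = 0
    | Sum.inr i, Sum.inr _ => i.val = 0
    | Sum.inl i, Sum.inr j => i.val = 0 ∧ j.val = 0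
    | Sum.inr _, Sum.inl _ => False

/-- If `H` has an edge then there are `H`-saturated graphs of every order. -/
theorem exists_isSaturated {W : Type*} {H : SimpleGraph W} (hH : H ≠ ⊥) (n : ℕ) :
    ∃ G : SimpleGraph (Fin n), IsSaturated H G := by
  obtain ⟨G, -, hG⟩ := (Set.toFinite {G : SimpleGraph (Fin n) | H.Free G}).exists_le_maximal
    (a := ⊥) (SimpleGraph.free_bot hH)
  refine ⟨G, hG.prop, fun x y hxy hadj => ?_⟩
  by_contra hfree
  exact (SimpleGraph.lt_sup_edge G x y hxy hadj).not_ge (hG.le_of_ge hfree le_sup_left)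

/-- If `H` has an edge then the minimum in the definition of `sat n H` is attained. -/
theorem exists_isSaturated_ncard_eq_sat {W : Type*} {H : SimpleGraph W} (hH : H ≠ ⊥) (n : ℕ) :
    ∃ G : SimpleGraph (Fin n), IsSaturated H G ∧ G.edgeSet.ncard = sat n H := by
  obtain ⟨G, hG⟩ := exists_isSaturated hH n
  exact Nat.sInf_mem
    (s := {m : ℕ | ∃ G : SimpleGraph (Fin n), IsSaturated H G ∧ G.edgeSet.ncard = m})
    ⟨_, G, hG, rfl⟩

end SaturationNumber

namespace SaturationNumber

open SimpleGraph

/-! Lower bound: put σ = s/(t+2) and discharge the weights deg v − s + σ. If x, y are nonadjacent of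
degree below s, neither can be the t-center of a copy created by xy, so one of them is its s-center.
That vertex has degree s − 1 and a neighbor of degree above t, or of degree t with no common
neighbor (`exists_witness_of_isSaturated`). Vertices of degree s − 1 with such witnesses split their
deficit 1 − σ equally among them. A witness of degree d > t can afford a load of d; one of degree t
can afford (t+1)/2, which suffices by `load_le_of_degree_eq`. The remaining vertices of degree below
s form a clique of order at most s, which costs only a constant (`sum_degree_ge`).

Upper bound: take K_s and disjoint stars with at least t + 1 leaves, paired so that the leaves of
two paired stars span an (s−2)-regular bipartite graph. Leaves then have degree s − 1, and only the
pairwise nonadjacent star centers have degree at least s. A star with t + 1 leaves has t + 2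
vertices and degree sum s(t+1), which gives the ratio. If parity leaves a vertex over, it is
inserted into deleted leaf-leaf edges and joined to one or two star centers. Saturation follows from
`isSaturated_doubleStar_of_partition`. -/

/-! ### Containment of double stars -/

/-- A graph contains the double star iff it has an edge whose ends have sufficiently many
neighbors that can be chosen disjointly. -/
theorem doubleStar_isContained_iff {V : Type*} {G : SimpleGraph V} {s t : ℕ}
    (hs : 1 ≤ s) (ht : 1 ≤ t) :
    (doubleStar s t).IsContained G ↔
      ∃ u v, G.Adj u v ∧ ∃ A B : Finset V, (∀ a ∈ A, G.Adj u a ∧ a ≠ v) ∧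
        (∀ b ∈ B, G.Adj v b ∧ b ≠ u) ∧ A.card + 1 = s ∧ B.card + 1 = t ∧ Disjoint A B := by
  classical
  obtain ⟨a, rfl⟩ : ∃ a, s = a + 1 := ⟨s - 1, by omega⟩
  obtain ⟨b, rfl⟩ : ∃ b, t = b + 1 := ⟨t - 1, by omega⟩
  constructor
  · rintro ⟨f⟩
    have hinj := f.injective
    refine ⟨f (Sum.inl 0), f (Sum.inr 0), f.toHom.map_adj (by simp [doubleStar]),
      Finset.univ.map ⟨fun i : Fin a => f (Sum.inl i.succ), fun i j h => by
        simpa using hinj h⟩,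
      Finset.univ.map ⟨fun i : Fin b => f (Sum.inr i.succ), fun i j h => by
        simpa using hinj h⟩, ?_, ?_, by simp, by simp, ?_⟩
    · intro x hx
      obtain ⟨i, -, rfl⟩ := Finset.mem_map.1 hx
      refine ⟨f.toHom.map_adj (by simp [doubleStar, (Fin.succ_ne_zero _).symm]), fun h => ?_⟩
      simpa using hinj h
    · intro x hx
      obtain ⟨i, -, rfl⟩ := Finset.mem_map.1 hx
      refine ⟨f.toHom.map_adj (by simp [doubleStar, (Fin.succ_ne_zero _).symm]), fun h => ?_⟩
      simpa using hinj h
    · rw [Finset.disjoint_left]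
      intro x hx hx'
      obtain ⟨i, -, rfl⟩ := Finset.mem_map.1 hx
      obtain ⟨j, -, h⟩ := Finset.mem_map.1 hx'
      simpa using hinj h
  · rintro ⟨u, v, huv, A, B, hA, hB, hAc, hBc, hAB⟩
    have eA : Fin a ≃ A := (finCongr (by omega)).trans A.equivFin.symm
    have eB : Fin b ≃ B := (finCongr (by omega)).trans B.equivFin.symm
    let f : Fin (a + 1) ⊕ Fin (b + 1) → V :=
      Sum.elim (Fin.cons u fun i => (eA i : V)) (Fin.cons v fun i => (eB i : V))
    have hAB' : ∀ i j, (eA i : V) ≠ eB j := fun i j h =>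
      Finset.disjoint_left.1 hAB (eA i).2 (h ▸ (eB j).2)
    have hA' := fun i => hA _ (eA i).2
    have hB' := fun i => hB _ (eB i).2
    refine ⟨⟨⟨f, ?_⟩, ?_⟩⟩
    · rintro (i | i) (j | j) h
      all_goals
        refine Fin.cases ?_ (fun i => ?_) i h <;> refine Fin.cases ?_ (fun j => ?_) j <;> intro h
      all_goals simp [doubleStar, f] at h ⊢
      · exact (hA' j).1
      · exact (hA' i).1.symm
      · exact huv
      · exact huv.symm
      · exact (hB' j).1
      · exact (hB' i).1.symm
    · show Function.Injective f
      rintro (i | i) (j | j)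
      all_goals
        refine Fin.cases ?_ (fun i => ?_) i <;> refine Fin.cases ?_ (fun j => ?_) j <;> intro h
      all_goals simp [f] at h ⊢
      · exact ((hA' j).1.ne h).elim
      · exact (hA' i).1.ne h.symm
      · exact h
      · exact huv.ne h
      · exact (hB' j).2 h.symm
      · exact (hA' i).2 h
      · exact hAB' _ _ h
      · exact huv.ne h.symm
      · exact (hA' j).2 h.symm
      · exact (hB' i).2 h
      · exact hAB' _ _ h.symm
      · exact ((hB' j).1.ne h).elim
      · exact (hB' i).1.ne h.symm
      · exact h

variable {V : Type*} [Fintype V] [DecidableEq V] {G : SimpleGraph V} [DecidableRel G.Adj]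

/-- A double star is contained in a graph as soon as the ends of some edge have sufficiently large
disjoint sets of further neighbors. -/
theorem doubleStar_isContained_of_le {W : Type*} {G : SimpleGraph W} {s t : ℕ} (hs : 1 ≤ s)
    (ht : 1 ≤ t) {u v : W} (huv : G.Adj u v) {A B : Finset W} (hA : ∀ a ∈ A, G.Adj u a ∧ a ≠ v)
    (hB : ∀ b ∈ B, G.Adj v b ∧ b ≠ u) (hAc : s ≤ A.card + 1) (hBc : t ≤ B.card + 1)
    (hAB : Disjoint A B) : (doubleStar s t).IsContained G := by
  rw [doubleStar_isContained_iff hs ht]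
  obtain ⟨A', hA', hA'c⟩ := Finset.exists_subset_card_eq (s := A) (n := s - 1) (by omega)
  obtain ⟨B', hB', hB'c⟩ := Finset.exists_subset_card_eq (s := B) (n := t - 1) (by omega)
  exact ⟨u, v, huv, A', B', fun a ha => hA a (hA' ha), fun b hb => hB b (hB' hb), by omega,
    by omega, hAB.mono hA' hB'⟩

/-! ### Lower bound: witnesses and discharging -/

/-- What saturation says about a nonadjacent pair of vertices of small degree. -/
theorem exists_witness_of_isSaturated {s t : ℕ} (hs : 2 ≤ s) (hst : s < t)
    (hG : IsSaturated (doubleStar s t) G) {x y : V} (hxy : x ≠ y) (hadj : ¬ G.Adj x y)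
    (hx : G.degree x < s) (hy : G.degree y < s) :
    ∃ p q, (p = x ∧ q = y ∨ p = y ∧ q = x) ∧ G.degree p + 1 = s ∧ ∃ z, G.Adj p z ∧
      (t < G.degree z ∨
        G.degree z = t ∧ Disjoint (G.neighborFinset p) (G.neighborFinset z) ∧ ¬ G.Adj z q) := by
  obtain ⟨u, v, huv, A, B, hA, hB, hAc, hBc, hAB⟩ :=
    (doubleStar_isContained_iff (by omega) (by omega)).1 (hG.2 x y hxy hadj)
  have hfree := hG.1
  simp only [Free, doubleStar_isContained_iff (show 1 ≤ s by omega) (show 1 ≤ t by omega)] at hfree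
  simp only [sup_adj, edge_adj] at huv hA hB
  -- Even with the new edge, p has at most s < t neighbors, while a t-center needs the t − 1 leaves
  -- in B and the other center w. Hence v is neither x nor y.
  have hdeg : ∀ p q, p ≠ q → G.degree p < s → (∀ b ∈ B, G.Adj p b ∨ b = q) → ∀ w,
      (G.Adj p w ∨ w = q) → w ∉ B → False := by
    intro p q hpq hp hb w hw hwB
    have h1 : insert w B ⊆ insert q (G.neighborFinset p) := by
      intro b hb'
      rw [Finset.mem_insert] at hb'
      rw [Finset.mem_insert, mem_neighborFinset]
      rcases hb' with rfl | hb'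
      · exact hw.symm
      · exact (hb b hb').symm
    have h2 := Finset.card_le_card h1
    have h3 := Finset.card_insert_le q (G.neighborFinset p)
    rw [Finset.card_insert_of_notMem hwB] at h2
    rw [card_neighborFinset_eq_degree] at h3
    omega
  have huB : u ∉ B := fun h => (hB u h).2 rfl
  have hvx : v ≠ x := by
    rintro rfl
    refine hdeg v y hxy hx (fun b hb => ?_) u ?_ huB
    · rcases (hB b hb).1 with h | h
      · exact .inl h
      · grind
    · rcases huv with h | h
      · exact .inl h.symm
      · grind
  have hvy : v ≠ y := by
    rintro rfl
    refine hdeg v x hxy.symm hy (fun b hb => ?_) u ?_ huB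
    · rcases (hB b hb).1 with h | h
      · exact .inl h
      · grind
    · rcases huv with h | h
      · exact .inl h.symm
      · grind
  have hB' : ∀ b ∈ B, G.Adj v b ∧ b ≠ u := by
    intro b hb
    have := hB b hb
    grind
  have huv' : G.Adj u v := by grind
  -- When u is an end of the new edge, A must fit into N(u) \ {v} together with q. Counting forces
  -- degree s − 1 and makes A that whole set.
  have key : ∀ p q, (p = x ∧ q = y ∨ p = y ∧ q = x) → u = p → G.degree p < s →
      ∃ p q, (p = x ∧ q = y ∨ p = y ∧ q = x) ∧ G.degree p + 1 = s ∧ ∃ z, G.Adj p z ∧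
      (t < G.degree z ∨
        G.degree z = t ∧ Disjoint (G.neighborFinset p) (G.neighborFinset z) ∧ ¬ G.Adj z q) := by
    rintro p q hpq rfl hp
    have hqv : q ≠ v := by grind
    have hAsub : A ⊆ insert q ((G.neighborFinset u).erase v) := by
      intro a ha
      have := hA a ha
      simp only [Finset.mem_insert, Finset.mem_erase, mem_neighborFinset]
      grind
    have hc : ((G.neighborFinset u).erase v).card + 1 = G.degree u := by
      rw [← card_neighborFinset_eq_degree, Finset.card_erase_add_one]
      simpa using huv'
    have h3 := Finset.card_insert_le q ((G.neighborFinset u).erase v)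
    have h4 := Finset.card_le_card hAsub
    have hAeq : A = insert q ((G.neighborFinset u).erase v) :=
      Finset.eq_of_subset_of_card_le hAsub (by omega)
    have hBsub : insert u B ⊆ G.neighborFinset v := by
      intro b hb
      rw [Finset.mem_insert] at hb
      rw [mem_neighborFinset]
      rcases hb with rfl | hb
      · exact huv'.symm
      · exact (hB' b hb).1
    have h5 := Finset.card_le_card hBsub
    rw [Finset.card_insert_of_notMem huB, card_neighborFinset_eq_degree] at h5
    refine ⟨u, q, hpq, by omega, v, huv', ?_⟩
    rcases (show t ≤ G.degree v by omega).lt_or_eq with h | h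
    · exact .inl h
    -- With degree exactly t there is no choice for B either, so A ∩ B = ∅ becomes a statement about
    -- full neighborhoods and about q.
    · have hBeq := Finset.eq_of_subset_of_card_le hBsub (by
        rw [Finset.card_insert_of_notMem huB, card_neighborFinset_eq_degree]; omega)
      refine .inr ⟨h.symm, ?_, fun hvq => ?_⟩
      · rw [← hBeq, Finset.disjoint_left]
        intro a ha hab
        rw [Finset.mem_insert] at hab
        rcases hab with rfl | hab
        · simp at ha
        · refine Finset.disjoint_left.1 hAB ?_ hab
          rw [hAeq, Finset.mem_insert, Finset.mem_erase]
          exact .inr ⟨(hB' a hab).1.ne', ha⟩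
      · have : q ∈ insert u B := by rw [hBeq]; simpa using hvq
        rw [Finset.mem_insert] at this
        rcases this with rfl | h'
        · grind
        · exact Finset.disjoint_left.1 hAB (by rw [hAeq]; exact Finset.mem_insert_self _ _) h'
  by_cases hux : u = x
  · exact key x y (.inl ⟨rfl, rfl⟩) hux hx
  by_cases huy : u = y
  · exact key y x (.inr ⟨rfl, rfl⟩) huy hy
  -- If neither center is an end of the new edge, the copy already lies in G.
  refine absurd ⟨u, v, huv', A, B, fun a ha => ?_, hB', hAc, hBc, hAB⟩ hfree
  have := hA a ha
  grind

/-- The neighbors of `x` of degree larger than `t`, if there are any, and otherwise the neighbors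
of degree `t` that have no common neighbor with `x`. -/
def witnesses (G : SimpleGraph V) [DecidableRel G.Adj] (t : ℕ) (x : V) : Finset V :=
  if ∃ z, G.Adj x z ∧ t < G.degree z then Finset.univ.filter fun z => G.Adj x z ∧ t < G.degree z
  else Finset.univ.filter fun z => G.Adj x z ∧ G.degree z = t ∧
    Disjoint (G.neighborFinset x) (G.neighborFinset z)

/-- The vertices of degree `s - 1` that have a witness. -/
def witnessed (G : SimpleGraph V) [DecidableRel G.Adj] (s t : ℕ) : Finset V :=
  {x | G.degree x + 1 = s ∧ (witnesses G t x).Nonempty}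

/-- The total share of the demands of the witnessed vertices that `z` has to satisfy. -/
noncomputable def load (G : SimpleGraph V) [DecidableRel G.Adj] (s t : ℕ) (z : V) : ℝ :=
  ∑ x ∈ witnessed G s t with z ∈ witnesses G t x, ((witnesses G t x).card : ℝ)⁻¹

theorem adj_of_mem_witnesses {t : ℕ} {x z : V} (h : z ∈ witnesses G t x) : G.Adj x z := by
  unfold witnesses at h
  split_ifs at h <;> simp at h <;> exact h.1

theorem le_degree_of_mem_witnesses {t : ℕ} {x z : V} (h : z ∈ witnesses G t x) :
    t ≤ G.degree z := by
  unfold witnesses at h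
  split_ifs at h <;> simp at h <;> omega

/-- Double counting: each witnessed vertex hands out a total of exactly 1. -/
theorem sum_load (s t : ℕ) : ∑ z, load G s t z = (witnessed G s t).card := by
  unfold load
  rw [Finset.sum_comm' (t' := witnessed G s t) (s' := fun x => witnesses G t x)
    (by intro x y; simp [and_comm]), Finset.card_eq_sum_ones, Nat.cast_sum]
  refine Finset.sum_congr rfl fun x hx => ?_
  have : (witnesses G t x).Nonempty := (Finset.mem_filter.1 hx).2.2
  have h : ((witnesses G t x).card : ℝ) ≠ 0 := by
    exact_mod_cast this.card_pos.ne'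
  simp [h]

theorem load_eq_zero {s t : ℕ} {z : V} (h : G.degree z < t) : load G s t z = 0 := by
  unfold load
  rw [Finset.filter_false_of_mem, Finset.sum_empty]
  intro x _ hx
  have := le_degree_of_mem_witnesses hx
  omega

theorem card_witnessed_filter_le (s t : ℕ) (z : V) :
    ((witnessed G s t).filter fun x => z ∈ witnesses G t x).card ≤ G.degree z := by
  rw [← card_neighborFinset_eq_degree]
  refine Finset.card_le_card fun x hx => ?_
  rw [mem_neighborFinset]
  exact (adj_of_mem_witnesses (Finset.mem_filter.1 hx).2).symm

theorem load_le_degree (s t : ℕ) (z : V) : load G s t z ≤ G.degree z := by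
  calc load G s t z ≤ ∑ x ∈ witnessed G s t with z ∈ witnesses G t x, (1 : ℝ) := by
        refine Finset.sum_le_sum fun x hx => ?_
        have : 0 < (witnesses G t x).card := Finset.card_pos.2 ⟨z, (Finset.mem_filter.1 hx).2⟩
        exact inv_le_one_of_one_le₀ (by exact_mod_cast this)
    _ ≤ G.degree z := by
        rw [Finset.sum_const, nsmul_eq_mul, mul_one]
        exact_mod_cast card_witnessed_filter_le s t z

/-- At most one vertex has z as its only witness; each other one contributes at most 1/2. Two such
vertices x, y would be nonadjacent, as x has no common neighbor with z. Saturation would then give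
one of them a witness not adjacent to the other, yet that witness must be z, which is adjacent to
both. -/
theorem load_le_of_degree_eq {s t : ℕ} (hs : 2 ≤ s) (hst : s < t)
    (hG : IsSaturated (doubleStar s t) G) {z : V} (hz : G.degree z = t) :
    load G s t z ≤ ((t : ℝ) + 1) / 2 := by
  set S := (witnessed G s t).filter fun x => z ∈ witnesses G t x with hS
  have hweak : ∀ x ∈ S, witnesses G t x =
      Finset.univ.filter fun z => G.Adj x z ∧ G.degree z = t ∧
        Disjoint (G.neighborFinset x) (G.neighborFinset z) := by
    intro x hx
    have hzx := (Finset.mem_filter.1 hx).2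
    unfold witnesses at hzx ⊢
    split_ifs at hzx with h
    · simp [hz] at hzx
    · rw [if_neg h]
  have hstrong : ∀ x ∈ S, ¬ ∃ z, G.Adj x z ∧ t < G.degree z := by
    intro x hx h
    have hzx := (Finset.mem_filter.1 hx).2
    simp [witnesses, if_pos h, hz] at hzx
  have hone : (S.filter fun x => (witnesses G t x).card = 1).card ≤ 1 := by
    rw [Finset.card_le_one]
    intro x hx y hy
    by_contra hxy
    obtain ⟨hxS, hx1⟩ := Finset.mem_filter.1 hx
    obtain ⟨hyS, hy1⟩ := Finset.mem_filter.1 hy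
    have hxz := (Finset.mem_filter.1 hxS).2
    have hyz := (Finset.mem_filter.1 hyS).2
    have hdx : G.degree x + 1 = s := (Finset.mem_filter.1 (Finset.mem_filter.1 hxS).1).2.1
    have hdy : G.degree y + 1 = s := (Finset.mem_filter.1 (Finset.mem_filter.1 hyS).1).2.1
    have hadj : ¬ G.Adj x y := by
      intro h
      have h1 := hxz
      rw [hweak x hxS] at h1
      simp only [Finset.mem_filter, Finset.mem_univ, true_and] at h1
      refine Finset.disjoint_left.1 h1.2.2 ((G.mem_neighborFinset x y).2 h) ?_
      simpa using (adj_of_mem_witnesses hyz).symm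
    obtain ⟨p, q, hpq, -, z', hpz', hz'⟩ :=
      exists_witness_of_isSaturated hs hst hG hxy hadj (by omega) (by omega)
    have hp : p ∈ S ∧ (witnesses G t p).card = 1 ∧ z ∈ witnesses G t p := by
      rcases hpq with ⟨rfl, rfl⟩ | ⟨rfl, rfl⟩
      · exact ⟨hxS, hx1, hxz⟩
      · exact ⟨hyS, hy1, hyz⟩
    have hq : G.Adj z q := by
      rcases hpq with ⟨rfl, rfl⟩ | ⟨rfl, rfl⟩
      · exact (adj_of_mem_witnesses hyz).symm
      · exact (adj_of_mem_witnesses hxz).symm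
    rcases hz' with h | ⟨h1, h2, h3⟩
    · exact hstrong p hp.1 ⟨z', hpz', h⟩
    · have hz'p : z' ∈ witnesses G t p := by
        rw [hweak p hp.1]
        simp [hpz', h1, h2]
      have := Finset.card_le_one.1 hp.2.1.le z hp.2.2 z' hz'p
      exact h3 (this ▸ hq)
  have hterm : ∀ x ∈ S, ((witnesses G t x).card : ℝ)⁻¹ ≤
      1 / 2 + if (witnesses G t x).card = 1 then 1 / 2 else 0 := by
    intro x hx
    have h0 : 0 < (witnesses G t x).card := Finset.card_pos.2 ⟨z, (Finset.mem_filter.1 hx).2⟩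
    split_ifs with h
    · norm_num [h]
    · rw [add_zero, one_div]
      refine inv_anti₀ (by norm_num) ?_
      exact_mod_cast (show 2 ≤ (witnesses G t x).card by omega)
  have hcard : (S.card : ℝ) ≤ t := by
    exact_mod_cast hz ▸ card_witnessed_filter_le s t z
  have hone' : ((S.filter fun x => (witnesses G t x).card = 1).card : ℝ) ≤ 1 := by
    exact_mod_cast hone
  calc load G s t z
      ≤ ∑ x ∈ S, (1 / 2 + if (witnesses G t x).card = 1 then (1 / 2 : ℝ) else 0) :=
        Finset.sum_le_sum hterm
    _ = S.card * (1 / 2) + (S.filter fun x => (witnesses G t x).card = 1).card * (1 / 2) := by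
        rw [Finset.sum_add_distrib, ← Finset.sum_filter]
        simp
    _ ≤ _ := by linarith

/-- The vertices of degree less than `s` without witness form a clique. -/
theorem adj_of_not_witnessed {s t : ℕ} (hs : 2 ≤ s) (hst : s < t)
    (hG : IsSaturated (doubleStar s t) G) {x y : V} (hxy : x ≠ y) (hx : G.degree x < s)
    (hy : G.degree y < s) (hx' : x ∉ witnessed G s t) (hy' : y ∉ witnessed G s t) :
    G.Adj x y := by
  by_contra hadj
  obtain ⟨p, q, hpq, hp, z, hpz, hz⟩ :=
    exists_witness_of_isSaturated hs hst hG hxy hadj hx hy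
  have : p ∈ witnessed G s t := by
    simp only [witnessed, Finset.mem_filter, Finset.mem_univ, true_and]
    refine ⟨hp, ?_⟩
    unfold witnesses
    split_ifs with h
    · obtain ⟨w, hw⟩ := h
      exact ⟨w, by simpa using hw⟩
    · rcases hz with hz | hz
      · exact absurd ⟨z, hpz, hz⟩ h
      · exact ⟨z, by simp [hpz, hz.1, hz.2.1]⟩
  rcases hpq with ⟨rfl, rfl⟩ | ⟨rfl, rfl⟩
  · exact hx' this
  · exact hy' this

theorem sum_degree_ge {s t : ℕ} (hs : 2 ≤ s) (hst : s < t)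
    (hG : IsSaturated (doubleStar s t) G) :
    -(s : ℝ) - (s : ℝ) ^ 2 / 4 + s * s / (t + 2) ≤
      ∑ v, ((G.degree v : ℝ) - s + s / (t + 2)) := by
  -- This is the largest density defect for degree t + 1: the inequality (1 − σ)d ≤ d − s + σ says
  -- σ(d + 1) ≥ s, with equality at d = t + 1.
  set σ : ℝ := s / (t + 2) with hσ
  have hs' : (2 : ℝ) ≤ s := by exact_mod_cast hs
  have hst' : (s : ℝ) + 1 ≤ t := by exact_mod_cast hst
  have hσt : σ * (t + 2) = s := by rw [hσ]; field_simp
  have hσ0 : 0 ≤ σ := by positivity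
  have hσ1 : σ ≤ 1 := by rw [hσ, div_le_one (by positivity)]; linarith
  set U := witnessed G s t with hU
  set Q : Finset V := Finset.univ.filter fun x => G.degree x < s ∧ x ∉ U with hQ
  have hUdeg : ∀ x ∈ U, G.degree x + 1 = s := fun x hx => (Finset.mem_filter.1 hx).2.1
  -- the large vertices pay for the witnessed ones
  have hpay : ∀ z, s ≤ G.degree z →
      (1 - σ) * load G s t z ≤ (G.degree z : ℝ) - s + σ := by
    intro z hz
    have hz' : (s : ℝ) ≤ G.degree z := by exact_mod_cast hz
    rcases lt_trichotomy (G.degree z) t with h | h | h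
    · rw [load_eq_zero h]; linarith
    · have h1 := load_le_of_degree_eq hs hst hG h
      have h2 : (1 - σ) * load G s t z ≤ (1 - σ) * (((t : ℝ) + 1) / 2) :=
        mul_le_mul_of_nonneg_left h1 (by linarith)
      rw [h]
      have h3 : σ * (t + 2) ≤ t - 1 := by linarith
      -- Since s = σ(t+2), the weight t − s + σ equals (1 − σ)(t+1) − 1, so it covers (1 − σ)(t+1)/2
      -- exactly when this holds.
      have h4 : (1 - σ) * (t + 1) ≥ 2 := by
        have : (1 - σ) * (t + 2) ≥ 3 := by linarith
        linarith
      nlinarith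
    · have h1 := load_le_degree (G := G) s t z
      have h2 : (1 - σ) * load G s t z ≤ (1 - σ) * G.degree z :=
        mul_le_mul_of_nonneg_left h1 (by linarith)
      have h3 : (t : ℝ) + 1 ≤ G.degree z := by exact_mod_cast h
      have h4 : σ * (t + 1) ≤ σ * G.degree z := mul_le_mul_of_nonneg_left h3 hσ0
      linarith
  -- The second summand is the transfer of charge; by `sum_load` it cancels in the sum over all v.
  have hsplit : ∀ v, (if v ∈ Q then (G.degree v : ℝ) - s + σ else 0) +
      ((1 - σ) * load G s t v - if v ∈ U then (1 - σ) else 0) ≤ (G.degree v : ℝ) - s + σ := by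
    intro v
    by_cases hv : s ≤ G.degree v
    · have hvQ : v ∉ Q := fun h => by have := (Finset.mem_filter.1 h).2.1; omega
      have hvU : v ∉ U := fun h => by have := hUdeg v h; omega
      rw [if_neg hvQ, if_neg hvU]
      linarith [hpay v hv]
    · rw [load_eq_zero (by omega)]
      by_cases hvU : v ∈ U
      · have hvQ : v ∉ Q := fun h => (Finset.mem_filter.1 h).2.2 hvU
        have : (G.degree v : ℝ) + 1 = s := by exact_mod_cast hUdeg v hvU
        rw [if_neg hvQ, if_pos hvU]
        linarith
      · have hvQ : v ∈ Q := by simp [hQ, hvU]; omega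
        rw [if_pos hvQ, if_neg hvU]
        linarith
  have htotal : ∑ v ∈ Q, ((G.degree v : ℝ) - s + σ) ≤ ∑ v, ((G.degree v : ℝ) - s + σ) := by
    refine le_trans (le_of_eq ?_) (Finset.sum_le_sum fun v _ => hsplit v)
    rw [Finset.sum_add_distrib (s := Finset.univ), Finset.sum_sub_distrib (s := Finset.univ),
      ← Finset.mul_sum, sum_load, ← Finset.sum_filter, ← Finset.sum_filter]
    simp only [Finset.filter_univ_mem, Finset.sum_const, nsmul_eq_mul]
    rw [← hU]
    ring
  refine le_trans ?_ htotal
  have hQdeg : ∀ v ∈ Q, Q.card ≤ G.degree v + 1 := by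
    intro v hv
    have hvQ := (Finset.mem_filter.1 hv).2
    rw [← Finset.card_erase_add_one hv, ← card_neighborFinset_eq_degree]
    refine Nat.succ_le_succ (Finset.card_le_card fun w hw => ?_)
    rw [Finset.mem_erase] at hw
    have hwQ := (Finset.mem_filter.1 hw.2).2
    rw [mem_neighborFinset]
    exact adj_of_not_witnessed hs hst hG hw.1.symm hvQ.1 hwQ.1 hvQ.2 hwQ.2
  have hQs : Q.card ≤ s := by
    rcases Q.eq_empty_or_nonempty with h | ⟨v, hv⟩
    · simp [h]
    · have := hQdeg v hv
      have := (Finset.mem_filter.1 hv).2.1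
      omega
  have hQs' : (Q.card : ℝ) ≤ s := by exact_mod_cast hQs
  have hQsum : (Q.card : ℝ) * (Q.card - 1 - s + σ) ≤ ∑ v ∈ Q, ((G.degree v : ℝ) - s + σ) := by
    rw [← nsmul_eq_mul]
    refine Finset.card_nsmul_le_sum _ _ _ fun v hv => ?_
    have : (Q.card : ℝ) ≤ G.degree v + 1 := by exact_mod_cast hQdeg v hv
    linarith
  refine le_trans ?_ hQsum
  have h1 : (s : ℝ) * s / (t + 2) = σ * s := by rw [hσ]; ring
  rw [h1]
  have h2 : σ * (s - Q.card) ≤ 1 * (s - Q.card) :=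
    mul_le_mul_of_nonneg_right hσ1 (by linarith)
  -- Writing q = |Q|: q² − sq ≥ −s²/4, and −(1 − σ)q ≥ −(1 − σ)s because q ≤ s.
  nlinarith [sq_nonneg ((Q.card : ℝ) - s / 2)]

/-- The lower bound for the number of edges of a saturated graph. -/
theorem ncard_edgeSet_ge {s t : ℕ} (hs : 2 ≤ s) (hst : s < t)
    (hG : IsSaturated (doubleStar s t) G) :
    ((s : ℝ) * (t + 1) / (t + 2)) * ((Fintype.card V : ℝ) / 2)
            - ((s : ℝ) * (t - s + 2) / (2 * t + 4) + (s : ℝ) ^ 2 / 8)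
      ≤ (G.edgeSet.ncard : ℝ) := by
  have h := sum_degree_ge hs hst hG
  have h2 : ∑ v, (G.degree v : ℝ) = 2 * G.edgeSet.ncard := by
    rw [Set.ncard_eq_toFinset_card' G.edgeSet]
    exact_mod_cast G.sum_degrees_eq_twice_card_edges
  rw [Finset.sum_add_distrib, Finset.sum_sub_distrib, h2] at h
  simp only [Finset.sum_const, nsmul_eq_mul, Finset.card_univ] at h
  have h3 : ((s : ℝ) * (t + 1) / (t + 2)) * ((Fintype.card V : ℝ) / 2)
      = (Fintype.card V * s - Fintype.card V * (s / (t + 2))) / 2 := by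
    field_simp
    ring
  have h4 : (s : ℝ) * (t - s + 2) / (2 * t + 4) = (s - s * s / (t + 2)) / 2 := by
    field_simp
    ring
  rw [h3, h4]
  linarith

/-! ### Upper bound: a sufficient condition for saturation -/

/-- A criterion for saturation: `Z` is an independent set of vertices with large private
neighborhoods, the other vertices have degree less than `s`, and each of them belongs to a clique
of order `s` or has a suitable neighbor. -/
theorem isSaturated_doubleStar_of_partition {s t : ℕ} (hs : 2 ≤ s) (hst : s < t)
    (Z K : Finset V) (L : V → Finset V)
    (hZ : ∀ z ∈ Z, ∀ z' ∈ Z, ¬ G.Adj z z')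
    (hdeg : ∀ v, v ∉ Z → G.degree v < s)
    (hK : ∀ x ∈ K, ∀ y ∈ K, x ≠ y → G.Adj x y) (hKs : K.card = s) (hKZ : Disjoint K Z)
    (hL : ∀ z ∈ Z, t ≤ (L z).card ∧ (∀ x ∈ L z, G.Adj z x) ∧ Disjoint (L z) K)
    (hLL : ∀ z ∈ Z, ∀ z' ∈ Z, z ≠ z' → Disjoint (L z) (L z'))
    (hflex : ∀ v, v ∉ Z → v ∉ K → G.degree v + 1 = s ∧
      ∃ z, G.Adj v z ∧ ∃ B : Finset V, t ≤ B.card ∧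
        ∀ b ∈ B, G.Adj z b ∧ b ≠ v ∧ ¬ G.Adj v b) :
    IsSaturated (doubleStar s t) G := by
  have hs1 : 1 ≤ s := by omega
  have ht1 : 1 ≤ t := by omega
  constructor
  · intro h
    obtain ⟨u, v, huv, A, B, hA, hB, hAc, hBc, -⟩ := (doubleStar_isContained_iff hs1 ht1).1 h
    -- Both centers of a copy have degree at least s, hence lie in the independent set Z, although
    -- they are adjacent.
    have hmem : ∀ u v, G.Adj u v → ∀ A : Finset V, (∀ a ∈ A, G.Adj u a ∧ a ≠ v) →
        s ≤ A.card + 1 → u ∈ Z := by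
      intro u v huv A hA hAc
      by_contra hu
      have h1 := hdeg u hu
      have h2 : insert v A ⊆ G.neighborFinset u := by
        intro a ha
        rw [mem_neighborFinset]
        rcases Finset.mem_insert.1 ha with rfl | ha
        · exact huv
        · exact (hA a ha).1
      have h3 := Finset.card_le_card h2
      rw [Finset.card_insert_of_notMem fun hv => (hA v hv).2 rfl,
        card_neighborFinset_eq_degree] at h3
      omega
    exact hZ u (hmem u v huv A hA (by omega)) v (hmem v u huv.symm B hB (by omega)) huv
  · intro x y hxy hadj
    -- Here x becomes the s-center, with y as its missing leaf. Only t − 1 leaves are needed at z,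
    -- so B can spare y.
    have hflex' : ∀ x y, x ≠ y → ¬ G.Adj x y → x ∉ Z → x ∉ K →
        (doubleStar s t).IsContained (G ⊔ edge x y) := by
      intro x y hxy hadj hxZ hxK
      obtain ⟨hd, z, hxz, B, hBc, hB⟩ := hflex x hxZ hxK
      refine doubleStar_isContained_of_le hs1 ht1 (u := x) (v := z) (by simp [hxz])
        (A := insert y ((G.neighborFinset x).erase z)) (B := B.erase y) ?_ ?_ ?_ ?_ ?_
      · intro a ha
        simp only [Finset.mem_insert, Finset.mem_erase, mem_neighborFinset] at ha
        simp only [sup_adj, edge_adj]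
        grind
      · intro b hb
        rw [Finset.mem_erase] at hb
        have := hB b hb.2
        simp only [sup_adj, edge_adj]
        grind
      · rw [Finset.card_insert_of_notMem (by simp [hadj])]
        have := Finset.card_erase_add_one (s := G.neighborFinset x) (a := z) (by simpa using hxz)
        rw [card_neighborFinset_eq_degree] at this
        omega
      · have := Finset.pred_card_le_card_erase (s := B) (a := y)
        omega
      · rw [Finset.disjoint_left]
        intro a ha hb
        simp only [Finset.mem_insert, Finset.mem_erase, mem_neighborFinset] at ha hb
        have := hB a hb.2
        grind
    -- The new edge joins the two centers: x uses the rest of the clique, y its private neighbors.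
    have hcenter : ∀ x y, x ≠ y → ¬ G.Adj x y → x ∈ K → y ∈ Z →
        (doubleStar s t).IsContained (G ⊔ edge x y) := by
      intro x y hxy hadj hxK hyZ
      obtain ⟨h1, h2, h3⟩ := hL y hyZ
      refine doubleStar_isContained_of_le hs1 ht1 (u := x) (v := y)
        (by simp [edge_adj, hxy]) (A := K.erase x) (B := L y) ?_ ?_ ?_ (by omega)
        (h3.symm.mono_left (Finset.erase_subset _ _))
      · intro a ha
        rw [Finset.mem_erase] at ha
        refine ⟨.inl (hK x hxK a ha.2 ha.1.symm), ?_⟩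
        rintro rfl
        exact Finset.disjoint_left.1 hKZ ha.2 hyZ
      · intro b hb
        refine ⟨.inl (h2 b hb), ?_⟩
        rintro rfl
        exact Finset.disjoint_left.1 h3 hb hxK
      · rw [Finset.card_erase_add_one hxK, hKs]
    by_cases hxZ : x ∈ Z <;> by_cases hyZ : y ∈ Z
    · obtain ⟨h1, h2, -⟩ := hL x hxZ
      obtain ⟨h3, h4, -⟩ := hL y hyZ
      refine doubleStar_isContained_of_le hs1 ht1 (u := x) (v := y)
        (by simp [edge_adj, hxy]) (A := L x) (B := L y) (fun a ha => ⟨.inl (h2 a ha), ?_⟩)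
        (fun b hb => ⟨.inl (h4 b hb), ?_⟩) (by omega) (by omega) (hLL x hxZ y hyZ hxy)
      · rintro rfl
        exact hadj (h2 a ha)
      · rintro rfl
        exact hadj (h4 b hb).symm
    · rw [edge_comm]
      by_cases hyK : y ∈ K
      · exact hcenter y x hxy.symm (fun h => hadj h.symm) hyK hxZ
      · exact hflex' y x hxy.symm (fun h => hadj h.symm) hyZ hyK
    · by_cases hxK : x ∈ K
      · exact hcenter x y hxy hadj hxK hyZ
      · exact hflex' x y hxy hadj hxZ hxK
    · by_cases hxK : x ∈ K
      · by_cases hyK : y ∈ K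
        · exact absurd (hK x hxK y hyK hxy) hadj
        · rw [edge_comm]
          exact hflex' y x hxy.symm (fun h => hadj h.symm) hyZ hyK
      · exact hflex' x y hxy hadj hxZ hxK

/-! ### Upper bound: the construction -/

/-- The vertices of a graph that consists of a clique of order `s`, of `2 * m` stars that come in
pairs, the two stars of the pair `p` having `ℓ p + 1` leaves each, and of `k` further vertices. -/
inductive StarVertex (s m : ℕ) (ℓ : Fin m → ℕ) (k : ℕ) : Type
  | clique (i : Fin s) : StarVertex s m ℓ k
  | center (p : Fin m) (b : Bool) : StarVertex s m ℓ k
  | leaf (p : Fin m) (b : Bool) (i : Fin (ℓ p + 1)) : StarVertex s m ℓ k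
  | extra (i : Fin k) : StarVertex s m ℓ k

namespace StarVertex

variable {s m : ℕ} {ℓ : Fin m → ℕ} {k : ℕ}

/-- `StarVertex` as a disjoint union. -/
def equivSum : StarVertex s m ℓ k ≃
    Fin s ⊕ (Fin m × Bool) ⊕ (Σ p : Fin m, Bool × Fin (ℓ p + 1)) ⊕ Fin k where
  toFun
    | clique i => .inl i
    | center p b => .inr (.inl (p, b))
    | leaf p b i => .inr (.inr (.inl ⟨p, b, i⟩))
    | extra i => .inr (.inr (.inr i))
  invFun
    | .inl i => clique i
    | .inr (.inl (p, b)) => center p b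
    | .inr (.inr (.inl ⟨p, b, i⟩)) => leaf p b i
    | .inr (.inr (.inr i)) => extra i
  left_inv x := by cases x <;> rfl
  right_inv x := by rcases x with i | ⟨p, b⟩ | ⟨p, b, i⟩ | i <;> rfl

instance : Fintype (StarVertex s m ℓ k) := Fintype.ofEquiv _ equivSum.symm

theorem sum_eq {M : Type*} [AddCommMonoid M] (f : StarVertex s m ℓ k → M) :
    ∑ x, f x = ∑ i, f (clique i) + (∑ p, (f (center p true) + f (center p false)) +
      (∑ p, (∑ i, f (leaf p true i) + ∑ i, f (leaf p false i)) + ∑ i, f (extra i))) := by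
  rw [← equivSum.symm.sum_comp, Fintype.sum_sum_type, Fintype.sum_sum_type,
    Fintype.sum_sum_type, Fintype.sum_prod_type, Fintype.sum_sigma]
  simp only [Fintype.sum_prod_type, Fintype.sum_bool]
  rfl

theorem card_eq : Fintype.card (StarVertex s m ℓ k) =
    s + (2 * m + (2 * ∑ p, (ℓ p + 1) + k)) := by
  rw [Fintype.card_eq_sum_ones, sum_eq]
  simp only [Finset.sum_const, Finset.card_univ, Fintype.card_fin, smul_eq_mul, mul_one,
    ← two_mul, ← Finset.mul_sum]
  ring

/-- The relation between the leaves of two paired stars which makes them induce a bipartite graph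
that is regular of degree `d`. -/
def LeafRel (d : ℕ) {n : ℕ} (b : Bool) (i j : Fin (n + 1)) : Prop :=
  if b then (i - j).val < d else (j - i).val < d

theorem leafRel_comm {d n : ℕ} {b : Bool} {i j : Fin (n + 1)} :
    LeafRel d (!b) j i ↔ LeafRel d b i j := by
  cases b <;> simp [LeafRel]

-- Subtraction in `Fin (n + 1)` is cyclic, so the relation is a circulant; a translation or
-- reflection carries its neighborhoods to the first d residues.
open scoped Classical in
theorem card_leafRel {d n : ℕ} (hd : d ≤ n + 1) (b : Bool) (i : Fin (n + 1)) :
    (Finset.univ.filter fun j => LeafRel d b i j).card = d := by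
  have h : (Finset.univ.filter fun j : Fin (n + 1) => j.val < d).card = d := by
    rw [Fin.card_filter_val_lt]
    omega
  refine Eq.trans ?_ h
  cases b
  · refine Finset.card_equiv (Equiv.subRight i) fun j => ?_
    simp [LeafRel]
  · refine Finset.card_equiv (Equiv.subLeft i) fun j => ?_
    simp [LeafRel]

/-- The adjacencies of the graph, in one direction. The first `e` pairs of stars miss an edge
between leaves, and the further vertices are joined to the ends of the missing edges. -/
inductive Rel (s m : ℕ) (ℓ : Fin m → ℕ) (k e : ℕ) :
    StarVertex s m ℓ k → StarVertex s m ℓ k → Prop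
  | clique (i j : Fin s) : Rel s m ℓ k e (clique i) (clique j)
  | center (p : Fin m) (b : Bool) (i : Fin (ℓ p + 1)) : Rel s m ℓ k e (center p b) (leaf p b i)
  | leaf (p : Fin m) (b : Bool) (i j : Fin (ℓ p + 1)) (h : LeafRel (s - 2) b i j)
      (h' : ¬ (p.val < e ∧ i = 0 ∧ j = 0)) : Rel s m ℓ k e (leaf p b i) (leaf p (!b) j)
  | extra_center (i : Fin k) (p : Fin m) (b : Bool) (hp : p.val = 0)
      (hb : b = false ∨ s % 2 = 1) : Rel s m ℓ k e (extra i) (center p b)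
  | extra_leaf (i : Fin k) (p : Fin m) (b : Bool) (hp : p.val < e) :
      Rel s m ℓ k e (extra i) (leaf p b 0)

/-- The graph that attains the upper bound. -/
def starGraph (s m : ℕ) (ℓ : Fin m → ℕ) (k e : ℕ) : SimpleGraph (StarVertex s m ℓ k) :=
  SimpleGraph.fromRel (Rel s m ℓ k e)

variable {e : ℕ}

theorem starGraph_adj_clique {i : Fin s} {y : StarVertex s m ℓ k} :
    (starGraph s m ℓ k e).Adj (clique i) y ↔ ∃ j, j ≠ i ∧ y = clique j := by
  constructor
  · rintro ⟨h, h' | h'⟩ <;> cases h'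
    all_goals exact ⟨_, by rintro rfl; exact h rfl, rfl⟩
  · rintro ⟨j, h, rfl⟩
    exact ⟨by simpa using h.symm, .inl (.clique _ _)⟩

theorem starGraph_adj_center {p : Fin m} {b : Bool} {y : StarVertex s m ℓ k} :
    (starGraph s m ℓ k e).Adj (center p b) y ↔ (∃ i, y = leaf p b i) ∨
      ∃ i, y = extra i ∧ p.val = 0 ∧ (b = false ∨ s % 2 = 1) := by
  constructor
  · rintro ⟨h, h' | h'⟩ <;> cases h'
    · exact .inl ⟨_, rfl⟩
    · exact .inr ⟨_, rfl, ‹_›, ‹_›⟩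
  · rintro (⟨i, rfl⟩ | ⟨i, rfl, h, h'⟩)
    · exact ⟨by simp, .inl (.center _ _ _)⟩
    · exact ⟨by simp, .inr (.extra_center _ _ _ h h')⟩

theorem starGraph_adj_leaf {p : Fin m} {b : Bool} {i : Fin (ℓ p + 1)} {y : StarVertex s m ℓ k} :
    (starGraph s m ℓ k e).Adj (leaf p b i) y ↔ y = center p b ∨
      (∃ j, y = leaf p (!b) j ∧ LeafRel (s - 2) b i j ∧ ¬ (p.val < e ∧ i = 0 ∧ j = 0)) ∨
      ∃ j, y = extra j ∧ p.val < e ∧ i = 0 := by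
  constructor
  · rintro ⟨h, h' | h'⟩
    · cases h'
      exact .inr (.inl ⟨_, rfl, ‹_›, ‹_›⟩)
    · generalize hx : leaf p b i = x at h'
      cases h' <;> cases hx
      · exact .inl rfl
      · refine .inr (.inl ⟨_, by rw [Bool.not_not], ?_, by tauto⟩)
        exact leafRel_comm.2 ‹_›
      · exact .inr (.inr ⟨_, rfl, ‹_›, rfl⟩)
  · rintro (rfl | ⟨j, rfl, h, h'⟩ | ⟨j, rfl, h, rfl⟩)
    · exact ⟨by simp, .inr (.center _ _ _)⟩
    · exact ⟨by simp, .inl (.leaf _ _ _ _ h h')⟩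
    · exact ⟨by simp, .inr (.extra_leaf _ _ _ h)⟩

theorem starGraph_adj_extra {i : Fin k} {y : StarVertex s m ℓ k} :
    (starGraph s m ℓ k e).Adj (extra i) y ↔
      (∃ p b, y = center p b ∧ p.val = 0 ∧ (b = false ∨ s % 2 = 1)) ∨
      ∃ p b, y = leaf p b 0 ∧ p.val < e := by
  constructor
  · rintro ⟨h, h' | h'⟩ <;> cases h'
    · exact .inl ⟨_, _, rfl, ‹_›, ‹_›⟩
    · exact .inr ⟨_, _, rfl, ‹_›⟩
  · rintro (⟨p, b, rfl, h, h'⟩ | ⟨p, b, rfl, h⟩)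
    · exact ⟨by simp, .inl (.extra_center _ _ _ h h')⟩
    · exact ⟨by simp, .inl (.extra_leaf _ _ _ h)⟩

open scoped Classical in
theorem degree_clique (i : Fin s) : (starGraph s m ℓ k e).degree (clique i) + 1 = s := by
  have : (starGraph s m ℓ k e).neighborFinset (clique i) =
      (Finset.univ.erase i).image clique := by
    ext y
    simp [starGraph_adj_clique, eq_comm]
  rw [← card_neighborFinset_eq_degree, this,
    Finset.card_image_of_injective _ fun i j h => by simpa using h,
    Finset.card_erase_add_one (Finset.mem_univ i), Finset.card_univ, Fintype.card_fin]

open scoped Classical in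
theorem degree_center_le (p : Fin m) (b : Bool) :
    (starGraph s m ℓ k e).degree (center p b) ≤
      ℓ p + 1 + if p.val = 0 ∧ (b = false ∨ s % 2 = 1) then k else 0 := by
  have : (starGraph s m ℓ k e).neighborFinset (center p b) ⊆
      Finset.univ.image (leaf p b) ∪
        if p.val = 0 ∧ (b = false ∨ s % 2 = 1) then Finset.univ.image extra else ∅ := by
    intro y
    rw [mem_neighborFinset, starGraph_adj_center]
    rintro (⟨i, rfl⟩ | ⟨i, rfl, h⟩)
    · simp
    · simp [h]
  rw [← card_neighborFinset_eq_degree]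
  refine (Finset.card_le_card this).trans ((Finset.card_union_le _ _).trans ?_)
  refine add_le_add (Finset.card_image_le.trans (by simp)) ?_
  split_ifs
  · exact Finset.card_image_le.trans (by simp)
  · simp

theorem leaf_injective (p : Fin m) (b : Bool) :
    Function.Injective (leaf p b : Fin (ℓ p + 1) → StarVertex s m ℓ k) :=
  fun i j h => by simpa using h

open scoped Classical in
theorem degree_leaf (hs : 2 ≤ s) (hℓ : ∀ p, s ≤ ℓ p) (hk : k ≤ 1) (he : e = k * (s / 2 - 1))
    (p : Fin m) (b : Bool) (i : Fin (ℓ p + 1)) :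
    (starGraph s m ℓ k e).degree (leaf p b i) + 1 = s := by
  have hc := card_leafRel (d := s - 2) (n := ℓ p) (by have := hℓ p; omega) b i
  rw [← card_neighborFinset_eq_degree]
  by_cases h : p.val < e ∧ i = 0
  · have hk1 : k = 1 := by
      rcases Nat.le_one_iff_eq_zero_or_eq_one.1 hk with rfl | rfl
      · omega
      · rfl
    subst hk1
    -- Having p < e forces s ≥ 4, so the edge between the two leaves 0 was present before its
    -- deletion; the extra vertex replaces it in the degree count.
    have hs2 : 0 < s - 2 := by omega
    have : (starGraph s m ℓ 1 e).neighborFinset (leaf p b i) =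
        insert (center p b) (insert (extra 0)
          (((Finset.univ.filter fun j => LeafRel (s - 2) b i j).erase 0).image (leaf p !b))) := by
      ext y
      simp only [mem_neighborFinset, starGraph_adj_leaf, Finset.mem_insert, Finset.mem_image,
        Finset.mem_erase, Finset.mem_filter, Finset.mem_univ, true_and, h, Fin.exists_fin_one]
      grind
    rw [this, Finset.card_insert_of_notMem (by simp), Finset.card_insert_of_notMem (by simp),
      Finset.card_image_of_injective _ (leaf_injective _ _), Finset.card_erase_add_one, hc]
    · omega
    · simp [h.2, LeafRel, hs2]
  · have : (starGraph s m ℓ k e).neighborFinset (leaf p b i) =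
        insert (center p b)
          ((Finset.univ.filter fun j => LeafRel (s - 2) b i j).image (leaf p !b)) := by
      ext y
      simp only [mem_neighborFinset, starGraph_adj_leaf, Finset.mem_insert, Finset.mem_image,
        Finset.mem_filter, Finset.mem_univ, true_and]
      grind
    rw [this, Finset.card_insert_of_notMem (by simp),
      Finset.card_image_of_injective _ (leaf_injective _ _), hc]
    omega

-- The e deleted edges supply 2(⌊s/2⌋ − 1) neighbors, and one center for even s or two for odd s
-- bring the total to s − 1.
open scoped Classical in
theorem degree_extra (hs : 2 ≤ s) (hm : 1 ≤ m) (hk : k ≤ 1) (he : e = k * (s / 2 - 1))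
    (hem : e ≤ m) (i : Fin k) : (starGraph s m ℓ k e).degree (extra i) + 1 = s := by
  have hk1 : k = 1 := by have := i.2; omega
  have : (starGraph s m ℓ k e).neighborFinset (extra i) =
      (Finset.univ.filter fun b => b = false ∨ s % 2 = 1).image (center ⟨0, hm⟩) ∪
        ((Finset.univ.filter fun p : Fin m => p.val < e) ×ˢ (Finset.univ : Finset Bool)).image
          fun q => leaf q.1 q.2 0 := by
    ext y
    simp only [mem_neighborFinset, starGraph_adj_extra, Finset.mem_union, Finset.mem_image,
      Finset.mem_product, Finset.mem_filter, Finset.mem_univ, true_and, and_true, Prod.exists]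
    refine or_congr ⟨?_, ?_⟩ (by grind)
    · rintro ⟨p, b, rfl, hp, hb⟩
      exact ⟨b, hb, by congr 1; exact Fin.ext hp.symm⟩
    · rintro ⟨b, hb, rfl⟩
      exact ⟨_, b, rfl, rfl, hb⟩
  rw [← card_neighborFinset_eq_degree, this, Finset.card_union_of_disjoint,
    Finset.card_image_of_injective _ fun a b h => by simpa using h,
    Finset.card_image_of_injOn, Finset.card_product, Fin.card_filter_val_lt, Finset.card_univ,
    Fintype.card_bool, min_eq_right hem]
  · subst hk1
    rcases Nat.mod_two_eq_zero_or_one s with h | h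
    · have : (Finset.univ.filter fun b : Bool => b = false ∨ s % 2 = 1).card = 1 := by
        rw [h]; rfl
      omega
    · have : (Finset.univ.filter fun b : Bool => b = false ∨ s % 2 = 1).card = 2 := by
        rw [h]; rfl
      omega
  · rintro ⟨p, b⟩ - ⟨p', b'⟩ - h
    simp only [leaf.injEq] at h
    exact Prod.ext h.1 h.2.1
  · rw [Finset.disjoint_left]
    intro y hy hy'
    obtain ⟨b, -, rfl⟩ := Finset.mem_image.1 hy
    obtain ⟨q, -, h⟩ := Finset.mem_image.1 hy'
    cases h

open scoped Classical in
theorem isSaturated_starGraph {t : ℕ} (hs : 2 ≤ s) (hst : s < t) (hm : 1 ≤ m)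
    (hℓ : ∀ p, t ≤ ℓ p) (hk : k ≤ 1) (he : e = k * (s / 2 - 1)) (hem : e ≤ m) :
    IsSaturated (doubleStar s t) (starGraph s m ℓ k e) := by
  have hℓ' : ∀ p, s ≤ ℓ p := fun p => by have := hℓ p; omega
  refine isSaturated_doubleStar_of_partition hs hst
    (Finset.univ.image fun q : Fin m × Bool => center q.1 q.2) (Finset.univ.image clique)
    (fun z => match z with
      | center p b => Finset.univ.image (leaf p b)
      | _ => ∅) ?_ ?_ ?_ ?_ ?_ ?_ ?_ ?_
  · simp only [Finset.mem_image, Finset.mem_univ, true_and]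
    rintro _ ⟨⟨p, b⟩, rfl⟩ _ ⟨⟨p', b'⟩, rfl⟩
    simp [starGraph_adj_center]
  · rintro (i | ⟨p, b⟩ | ⟨p, b, i⟩ | i) hv
    · have := degree_clique (m := m) (ℓ := ℓ) (k := k) (e := e) i; omega
    · simp at hv
    · have := degree_leaf hs hℓ' hk he p b i; omega
    · have := degree_extra (ℓ := ℓ) hs hm hk he hem i; omega
  · simp only [Finset.mem_image, Finset.mem_univ, true_and]
    rintro _ ⟨i, rfl⟩ _ ⟨j, rfl⟩ h
    exact starGraph_adj_clique.2 ⟨j, by rintro rfl; exact h rfl, rfl⟩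
  · rw [Finset.card_image_of_injective _ fun i j h => by simpa using h]
    simp
  · simp [Finset.disjoint_left]
  · simp only [Finset.mem_image, Finset.mem_univ, true_and]
    rintro _ ⟨⟨p, b⟩, rfl⟩
    refine ⟨?_, ?_, ?_⟩
    · simp only [Finset.card_image_of_injective _ (leaf_injective p b), Finset.card_univ,
        Fintype.card_fin]
      exact (hℓ p).trans (Nat.le_succ _)
    · simp [starGraph_adj_center]
    · simp [Finset.disjoint_left]
  · simp only [Finset.mem_image, Finset.mem_univ, true_and]
    rintro _ ⟨⟨p, b⟩, rfl⟩ _ ⟨⟨p', b'⟩, rfl⟩ h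
    rw [Finset.disjoint_left]
    intro y hy hy'
    obtain ⟨i, -, rfl⟩ := Finset.mem_image.1 hy
    obtain ⟨j, -, h'⟩ := Finset.mem_image.1 hy'
    simp only [leaf.injEq] at h'
    exact h (by rw [h'.1, h'.2.1])
  · rintro (i | ⟨p, b⟩ | ⟨p, b, i⟩ | i) hv hv'
    · simp at hv'
    · simp at hv
    · refine ⟨degree_leaf hs hℓ' hk he p b i, center p b, starGraph_adj_leaf.2 (.inl rfl),
        (Finset.univ.erase i).image (leaf p b), ?_, ?_⟩
      · rw [Finset.card_image_of_injective _ (leaf_injective p b), Finset.card_erase_of_mem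
          (Finset.mem_univ _), Finset.card_univ, Fintype.card_fin]
        exact hℓ p
      · simp +contextual [starGraph_adj_center, starGraph_adj_leaf]
    -- Leaf 0 is left out because the extra vertex may be adjacent to it; at least t leaves remain.
    · refine ⟨degree_extra hs hm hk he hem i, center ⟨0, hm⟩ false,
        starGraph_adj_extra.2 (.inl ⟨_, _, rfl, rfl, .inl rfl⟩),
        (Finset.univ.erase 0).image (leaf ⟨0, hm⟩ false), ?_, ?_⟩
      · rw [Finset.card_image_of_injective _ (leaf_injective _ _), Finset.card_erase_of_mem
          (Finset.mem_univ _), Finset.card_univ, Fintype.card_fin]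
        exact hℓ _
      · intro y hy
        obtain ⟨j, hj, rfl⟩ := Finset.mem_image.1 hy
        refine ⟨starGraph_adj_center.2 (.inl ⟨_, rfl⟩), by simp, ?_⟩
        rw [starGraph_adj_extra]
        rintro (⟨p, b, h, -⟩ | ⟨p, b, h, -⟩)
        · cases h
        · simp only [leaf.injEq] at h
          obtain ⟨rfl, rfl, h⟩ := h
          exact (Finset.mem_erase.1 hj).1 (eq_of_heq h)

/-- In the degree sum, each leaf accounts for s: its own s − 1 and 1 at its center. The extra vertex
accounts for s − 1 and 1 + (s mod 2) at centers. -/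
theorem two_mul_ncard_edgeSet_starGraph_le (hs : 2 ≤ s) (hm : 1 ≤ m)
    (hℓ : ∀ p, s ≤ ℓ p) (hk : k ≤ 1) (he : e = k * (s / 2 - 1)) (hem : e ≤ m) :
    2 * (starGraph s m ℓ k e).edgeSet.ncard ≤
      s * (s - 1) + 2 * s * ∑ p, (ℓ p + 1) + k * (s + s % 2) := by
  classical
  rw [Set.ncard_eq_toFinset_card' (starGraph s m ℓ k e).edgeSet]
  have h := (starGraph s m ℓ k e).sum_degrees_eq_twice_card_edges
  rw [edgeFinset] at h
  rw [← h, sum_eq]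
  have h1 : ∀ i, (starGraph s m ℓ k e).degree (clique i) = s - 1 := fun i => by
    have := degree_clique (m := m) (ℓ := ℓ) (k := k) (e := e) i; omega
  have h2 : ∀ p b i, (starGraph s m ℓ k e).degree (leaf p b i) = s - 1 := fun p b i => by
    have := degree_leaf hs hℓ hk he p b i; omega
  have h3 : ∀ i, (starGraph s m ℓ k e).degree (extra i) = s - 1 := fun i => by
    have := degree_extra (ℓ := ℓ) hs hm hk he hem i; omega
  have h4 : ∑ p, ((starGraph s m ℓ k e).degree (center p true) +
      (starGraph s m ℓ k e).degree (center p false)) ≤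
      2 * ∑ p, (ℓ p + 1) + k * (1 + s % 2) := by
    calc _ ≤ ∑ p : Fin m, (2 * (ℓ p + 1) +
            if p = ⟨0, hm⟩ then k * (1 + s % 2) else 0) := by
          refine Finset.sum_le_sum fun p _ => ?_
          have h5 := degree_center_le (s := s) (ℓ := ℓ) (k := k) (e := e) p true
          have h6 := degree_center_le (s := s) (ℓ := ℓ) (k := k) (e := e) p false
          by_cases hp : p = ⟨0, hm⟩
          · subst hp
            rcases Nat.mod_two_eq_zero_or_one s with h | h <;> simp [h] at h5 h6 ⊢ <;> omega
          · have hp' : p.val ≠ 0 := fun h => hp (Fin.ext h)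
            simp [hp'] at h5 h6
            simp [hp]
            omega
      _ = _ := by
          rw [Finset.sum_add_distrib, ← Finset.mul_sum]
          simp
  simp only [h1, h2, h3, Finset.sum_const, Finset.card_univ, Fintype.card_fin, smul_eq_mul]
  obtain ⟨r, rfl⟩ : ∃ r, s = r + 1 := ⟨s - 1, by omega⟩
  rw [Nat.add_sub_cancel]
  have h5 : ∑ p, ((ℓ p + 1) * r + (ℓ p + 1) * r) = 2 * r * ∑ p, (ℓ p + 1) := by
    rw [Finset.mul_sum]
    exact Finset.sum_congr rfl fun p _ => by ring
  rw [h5]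
  linarith

end StarVertex

/-! ### Bounds for the saturation number -/

theorem IsSaturated.of_iso {W V V' : Type*} {H : SimpleGraph W} {G : SimpleGraph V}
    {G' : SimpleGraph V'} (h : IsSaturated H G) (f : G ≃g G') : IsSaturated H G' := by
  refine ⟨fun h' => h.1 (h'.trans ⟨f.symm.toCopy⟩), fun x y hxy hadj => ?_⟩
  have h1 := h.2 (f.symm x) (f.symm y) (f.symm.injective.ne hxy)
    (fun h' => hadj (f.symm.map_adj_iff.1 h'))
  refine h1.trans ⟨⟨⟨f, fun {a b} hab => ?_⟩, f.injective⟩⟩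
  simp only [sup_adj, edge_adj] at hab ⊢
  rcases hab with hab | ⟨hab, hne⟩
  · exact .inl (f.map_adj_iff.2 hab)
  · refine .inr ⟨?_, f.injective.ne hne⟩
    rcases hab with ⟨rfl, rfl⟩ | ⟨rfl, rfl⟩ <;> simp

theorem sat_le_ncard_edgeSet {W V : Type*} [Fintype V] {H : SimpleGraph W} {G : SimpleGraph V}
    (h : IsSaturated H G) : sat (Fintype.card V) H ≤ G.edgeSet.ncard := by
  classical
  let f := Iso.map (Fintype.equivFin V) G
  refine Nat.sInf_le ⟨_, h.of_iso f, ?_⟩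
  exact (Nat.card_congr f.mapEdgeSet).symm

theorem sat_doubleStar_le {s t n : ℕ} (hs : 2 ≤ s) (hst : s < t)
    (hn : max 1 (s / 2 - 1) * (2 * t + 4) + s ≤ n) :
    (sat n (doubleStar s t) : ℝ) ≤ ((s : ℝ) * (t + 1) / (t + 2)) * ((n : ℝ) / 2)
            + ((s : ℝ) * (s - 1) / (2 * t + 4) + (⌈(s : ℝ) / 2⌉ : ℝ)) := by
  -- `m` pairs of stars, `2 * h + k` vertices that remain
  obtain ⟨m, r, hr, hmr⟩ : ∃ m r, r < 2 * t + 4 ∧ n = s + (m * (2 * t + 4) + r) :=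
    ⟨(n - s) / (2 * t + 4), (n - s) % (2 * t + 4), Nat.mod_lt _ (by omega), by
      have := Nat.div_add_mod' (n - s) (2 * t + 4)
      omega⟩
  -- The threshold on n provides enough pairs for all deleted edges, which lie in different pairs.
  have hm : max 1 (s / 2 - 1) ≤ m := by
    by_contra! h
    have : (m + 1) * (2 * t + 4) ≤ max 1 (s / 2 - 1) * (2 * t + 4) := Nat.mul_le_mul_right _ h
    rw [add_one_mul] at this
    omega
  obtain ⟨h, k, hk, rfl⟩ : ∃ h k, k ≤ 1 ∧ r = 2 * h + k := ⟨r / 2, r % 2, by omega, by omega⟩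
  have hm1 : 1 ≤ m := (le_max_left _ _).trans hm
  have hm2 : k * (s / 2 - 1) ≤ m :=
    (Nat.mul_le_mul_right _ hk).trans ((one_mul _).le.trans ((le_max_right _ _).trans hm))
  -- The 2h spare vertices become h additional leaves on each star of the first pair.
  let ℓ : Fin m → ℕ := fun p => t + if p = ⟨0, hm1⟩ then h else 0
  have hℓ : ∀ p, t ≤ ℓ p := fun p => Nat.le_add_right _ _
  have hsum : ∑ p, (ℓ p + 1) = m * (t + 1) + h := by
    simp [ℓ, Finset.sum_add_distrib]
    ring
  have hcard := StarVertex.card_eq (s := s) (ℓ := ℓ) (k := k)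
  have hle := sat_le_ncard_edgeSet (StarVertex.isSaturated_starGraph hs hst hm1 hℓ hk rfl hm2)
  have hedge := StarVertex.two_mul_ncard_edgeSet_starGraph_le (e := k * (s / 2 - 1)) hs hm1
    (fun p => hst.le.trans (hℓ p)) hk rfl hm2
  rw [hcard, hsum, show s + (2 * m + (2 * (m * (t + 1) + h) + k)) = n by rw [hmr]; ring] at hle
  rw [hsum] at hedge
  have hceil : (s : ℝ) + (s % 2 : ℕ) ≤ 2 * ⌈(s : ℝ) / 2⌉ := by
    have h1 : (s : ℝ) / 2 ≤ ⌈(s : ℝ) / 2⌉ := Int.le_ceil _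
    have h2 : (s : ℤ) ≤ 2 * ⌈(s : ℝ) / 2⌉ := by
      have : (s : ℝ) ≤ 2 * ⌈(s : ℝ) / 2⌉ := by linarith
      exact_mod_cast this
    have h3 : (s : ℤ) + (s % 2 : ℕ) ≤ 2 * ⌈(s : ℝ) / 2⌉ := by omega
    have h4 := (Int.cast_le (R := ℝ)).2 h3
    simpa only [Int.cast_add, Int.cast_natCast, Int.cast_mul, Int.cast_ofNat] using h4
  have hmain : 2 * (sat n (doubleStar s t) : ℝ) ≤
      s * (s - 1) + 2 * s * (m * (t + 1) + h) + k * (s + (s % 2 : ℕ)) := by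
    have h1 : 2 * sat n (doubleStar s t) ≤
        s * (s - 1) + 2 * s * (m * (t + 1) + h) + k * (s + s % 2) := by omega
    have h2 : ((s - 1 : ℕ) : ℝ) = s - 1 := by
      rw [Nat.cast_sub (by omega)]; simp
    have h3 : ((2 * sat n (doubleStar s t) : ℕ) : ℝ) ≤
        ((s * (s - 1) + 2 * s * (m * (t + 1) + h) + k * (s + s % 2) : ℕ) : ℝ) := by
      exact_mod_cast h1
    push_cast [h2] at h3 ⊢
    exact h3
  have hn' : (n : ℝ) = s + (m * (2 * t + 4) + (2 * h + k)) := by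
    rw [hmr]; push_cast; ring
  have hs' : (0 : ℝ) ≤ s := by positivity
  have hr' : (2 * h + k : ℝ) + 1 ≤ 2 * t + 4 := by exact_mod_cast hr
  have hfin : (s * (s - 1) + 2 * s * (m * (t + 1) + h) + k * (s + (s % 2 : ℕ)) : ℝ) ≤
      2 * (((s : ℝ) * (t + 1) / (t + 2)) * ((n : ℝ) / 2)
            + ((s : ℝ) * (s - 1) / (2 * t + 4) + (⌈(s : ℝ) / 2⌉ : ℝ))) := by
    have h1 : 2 * (((s : ℝ) * (t + 1) / (t + 2)) * ((n : ℝ) / 2)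
            + ((s : ℝ) * (s - 1) / (2 * t + 4) + (⌈(s : ℝ) / 2⌉ : ℝ))) =
        s * s + s * (2 * m * (t + 1) + 2 * h + k) - s * ((2 * h + k : ℝ) + 1) / (t + 2)
          + 2 * ⌈(s : ℝ) / 2⌉ := by
      rw [hn']
      field_simp
      ring
    -- The remainder is at most 2t + 3, so this loss is at most 2s; the s left over from s² − s(s−1)
    -- and the ceiling term absorb it.
    have h2 : s * ((2 * h + k : ℝ) + 1) / (t + 2) ≤ 2 * s := by
      rw [div_le_iff₀ (by positivity)]
      nlinarith
    rw [h1]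
    have h3 : (0 : ℝ) ≤ (s % 2 : ℕ) := by positivity
    have h4 : (k : ℝ) * (s % 2 : ℕ) ≤ (s % 2 : ℕ) :=
      mul_le_of_le_one_left h3 (by exact_mod_cast hk)
    linarith
  linarith

theorem le_sat_doubleStar {s t : ℕ} (hs : 2 ≤ s) (hst : s < t) (n : ℕ) :
    ((s : ℝ) * (t + 1) / (t + 2)) * ((n : ℝ) / 2)
            - ((s : ℝ) * (t - s + 2) / (2 * t + 4) + (s : ℝ) ^ 2 / 8)
      ≤ (sat n (doubleStar s t) : ℝ) := by
  classical
  have hH : doubleStar s t ≠ ⊥ := by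
    intro h
    have : (doubleStar s t).Adj (.inl ⟨0, by omega⟩) (.inr ⟨0, by omega⟩) := by
      simp [doubleStar]
    rw [h] at this
    exact this
  obtain ⟨G, hG, h⟩ := exists_isSaturated_ncard_eq_sat hH n
  rw [← h]
  simpa using ncard_edgeSet_ge hs hst hG

end SaturationNumber

theorem mainTheorem1 (s t : ℕ) (hs : 2 ≤ s) (hst : s < t) :
    (∀ n : ℕ, max 1 (s / 2 - 1) * (2 * t + 4) + s ≤ n →
      ((s : ℝ) * (t + 1) / (t + 2)) * ((n : ℝ) / 2)
            - ((s : ℝ) * (t - s + 2) / (2 * t + 4) + (s : ℝ) ^ 2 / 8)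
          ≤ (SaturationNumber.sat n (SaturationNumber.doubleStar s t) : ℝ) ∧
        (SaturationNumber.sat n (SaturationNumber.doubleStar s t) : ℝ)
          ≤ ((s : ℝ) * (t + 1) / (t + 2)) * ((n : ℝ) / 2)
            + ((s : ℝ) * (s - 1) / (2 * t + 4) + (⌈(s : ℝ) / 2⌉ : ℝ))) ∧
    Asymptotics.IsBigO Filter.atTop
      (fun n : ℕ => (SaturationNumber.sat n (SaturationNumber.doubleStar s t) : ℝ)
        - ((s : ℝ) * t + s) * n / (2 * t + 4))
      (fun _ : ℕ => (1 : ℝ)) := by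
  refine ⟨fun n hn => ⟨SaturationNumber.le_sat_doubleStar hs hst n,
    SaturationNumber.sat_doubleStar_le hs hst hn⟩, ?_⟩
  refine Asymptotics.IsBigO.of_bound
    (|(s : ℝ) * (t - s + 2) / (2 * t + 4) + (s : ℝ) ^ 2 / 8| +
      |(s : ℝ) * (s - 1) / (2 * t + 4) + (⌈(s : ℝ) / 2⌉ : ℝ)|) ?_
  filter_upwards [Filter.eventually_ge_atTop (max 1 (s / 2 - 1) * (2 * t + 4) + s)] with n hn
  have h1 := SaturationNumber.le_sat_doubleStar hs hst n
  have h2 := SaturationNumber.sat_doubleStar_le hs hst hn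
  have h3 : ((s : ℝ) * t + s) * n / (2 * t + 4) =
      ((s : ℝ) * (t + 1) / (t + 2)) * ((n : ℝ) / 2) := by
    field_simp
    ring
  rw [h3, norm_one, mul_one, Real.norm_eq_abs, abs_le]
  constructor
  · linarith [le_abs_self ((s : ℝ) * (t - s + 2) / (2 * t + 4) + (s : ℝ) ^ 2 / 8),
      abs_nonneg ((s : ℝ) * (s - 1) / (2 * t + 4) + (⌈(s : ℝ) / 2⌉ : ℝ))]
  · linarith [abs_nonneg ((s : ℝ) * (t - s + 2) / (2 * t + 4) + (s : ℝ) ^ 2 / 8),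
      le_abs_self ((s : ℝ) * (s - 1) / (2 * t + 4) + (⌈(s : ℝ) / 2⌉ : ℝ))]
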